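/- There exist universal constants $C,c>0$ and a positive function $\zeta$ of five real variables such that the following holds. Setting. Let $n\ge 1$, let $X\in\mathbb{R}^{n\times p}$ be a fixed design matrix with columns normalized so that $\|X_j\|^2\le n$ for all $j$, let $\beta^*\in\mathbb{R}^p$ be nonzero with support $S^*$, $s=|S^*|\ge1$, and let $y=X\beta^*+\varepsilon$. One observes $y$ and $Z=X+A$. Here the rows of $A$ are i.i.d. with mean zero, covariance matrix $\Sigma_A$ with $\lambda_{\max}(\Sigma_A)>0$, and sub-Gaussian parameter $\tau^2$ (i.e. $\mathbb{E}\exp(t\langle u,a\rangle)\le\exp(\tau^2t^2/2)$ for each row $a$, every unit vector $u$ and every $t\in\mathbb{R}$); the entries of $\varepsilon$ are i.i.d. with $\mathbb{E}\exp(t\varepsilon_i)\le\exp(\sigma^2t^2/2)$ for all $t\in\mathbb{R}$; $\tau,\sigma>0$; and $A$ and $\varepsilon$ are independent. Put $\Sigma=\frac1nX^\top X$, $\widehat\Sigma=\frac1nZ^\top Z-\Sigma_A$, $\widehat\xi=\frac1nZ^\top y$. Fix $\widehat\epsilon>0$ and, with an eigenvalue decomposition $\widehat\Sigma=P\,\mathrm{Diag}(\theta_1,\dots,\theta_p)P^\top$,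 put $$\widetilde Z=\sqrt n\,P\,\mathrm{Diag}\big(\sqrt{\max(\theta_i,\widehat\epsilon)}\big)P^\top,\qquad \widetilde y=\sqrt n\,P\,\mathrm{Diag}\big(1/\sqrt{\max(\theta_i,\widehat\epsilon)}\big)P^\top\widehat\xi .$$ Algorithm. Let $a>1$ and $\phi(t)=\frac{a-1}{a+1}t^2+\frac{2}{a+1}t$. Given $\lambda>0$, $\rho_0=1$ and $w^0\in[0,\frac12]^p$, for $k=1,2,\dots$: let $\beta^k$ minimize $\frac1{2n}\|\widetilde Z\beta-\widetilde y\|^2+\lambda\sum_{i=1}^p(1-w_i^{k-1})|\beta_i|$ over $\beta\in\mathbb{R}^p$; choose $\rho_k\ge\rho_{k-1}$ if $k\le3$ and $\rho_k=\rho_{k-1}$ if $k>3$; let $w_i^k$ minimize $\phi(t)-\rho_k t|\beta_i^k|$ over $t\in[0,1]$, for each $i$. Claim. Let $\kappa>0$ and suppose that $\Sigma$ satisfies the $\kappa$-restricted eigenvalue condition: $\beta^\top\Sigma\beta\ge\kappa\|\beta\|^2$ for every $\beta$ such that $\|\beta_{S^c}\|_1\le3\|\beta_S\|_1$ for some $S\supseteq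 S^*$ with $|S|\le1.5s$. Let $K=2(\lambda_{\max}(\Sigma_A)+\widehat\epsilon)\|\beta^*\|_1$. Then, with probability at least $$1-C\,p^2\exp\big(-c\,n\,s^{-2}\zeta^{-1}\big),\qquad \zeta=\zeta\big(\|\beta^*\|_1,\tau^2,\sigma^2,\kappa,\lambda_{\max}(\Sigma_A)\big),$$ every run of the algorithm with $\lambda\ge8K$ and $\rho_3\le\frac{\kappa}{4\sqrt2\,\lambda}$ satisfies $$\|\beta^k-\beta^*\|\le\frac{4\sqrt s\,\lambda}{\kappa}\qquad\text{for all }k\ge1 .$$ -/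

import Mathlib

open MeasureTheory ProbabilityTheory
open scoped NNReal Matrix

noncomputable section

/-- The support `S*` of a coefficient vector. -/
def suppSet {p : ℕ} (b : Fin p → ℝ) : Finset (Fin p) :=
  Finset.univ.filter fun j => b j ≠ 0

/-- The `ℓ₁` norm of a vector. -/
def l1norm {p : ℕ} (b : Fin p → ℝ) : ℝ := ∑ j, |b j|

/-- The `ℓ₂` (Euclidean) norm of a vector. -/
def l2norm {p : ℕ} (b : Fin p → ℝ) : ℝ := ‖WithLp.toLp 2 b‖

/-- The largest eigenvalue of a real symmetric matrix. -/
def lamMax {p : ℕ} (M : Matrix (Fin p) (Fin p) ℝ) : ℝ := sSup (spectrum ℝ M)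

/-- The Gram matrix `Σ = n⁻¹ Xᵀ X` of a design matrix. -/
def gram {n p : ℕ} (X : Matrix (Fin n) (Fin p) ℝ) : Matrix (Fin p) (Fin p) ℝ :=
  (1 / (n : ℝ)) • (Xᵀ * X)

/-- The set `𝒞(T)`: the union, over all `S ⊇ T` with `|S| ≤ 1.5 |T|`, of the cones
`{b : ‖b_{Sᶜ}‖₁ ≤ 3 ‖b_S‖₁}`. -/
def restrictedCone {p : ℕ} (T : Finset (Fin p)) : Set (Fin p → ℝ) :=
  {b | ∃ S : Finset (Fin p), T ⊆ S ∧ (S.card : ℝ) ≤ 3 / 2 * (T.card : ℝ) ∧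
    ∑ j ∈ Sᶜ, |b j| ≤ 3 * ∑ j ∈ S, |b j|}

/-- The `κ`-restricted eigenvalue condition for the matrix `M` on `𝒞(T)`. -/
def RestrictedEigenvalue {p : ℕ} (M : Matrix (Fin p) (Fin p) ℝ) (T : Finset (Fin p))
    (κ : ℝ) : Prop :=
  0 < κ ∧ ∀ b ∈ restrictedCone T, κ * l2norm b ^ 2 ≤ b ⬝ᵥ (M *ᵥ b)

/-- The additive measurement error model with sub-Gaussian errors. `A` is the matrix of
measurement errors: its rows are i.i.d., centred, with covariance matrix `SigA`, and sub-Gaussian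
with parameter `τ²` (every one-dimensional projection along a unit vector is). The noise `ε` has
i.i.d. sub-Gaussian entries with parameter `σ²`, and `A` and `ε` are independent. -/
structure AdditiveErrorModel {Ω : Type*} [MeasurableSpace Ω] (P : Measure Ω) {n p : ℕ}
    (A : Ω → Matrix (Fin n) (Fin p) ℝ) (ε : Ω → Fin n → ℝ)
    (SigA : Matrix (Fin p) (Fin p) ℝ) (τ σ : ℝ≥0) : Prop where
  measurable_A : ∀ i j, Measurable fun ω => A ω i j
  measurable_ε : ∀ i, Measurable fun ω => ε ω i
  rows_indep : iIndepFun (fun (i : Fin n) (ω : Ω) (j : Fin p) => A ω i j) P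
  rows_identDistrib : ∀ i i' : Fin n,
    IdentDistrib (fun (ω : Ω) (j : Fin p) => A ω i j) (fun (ω : Ω) (j : Fin p) => A ω i' j) P P
  rows_mean : ∀ i j, ∫ ω, A ω i j ∂P = 0
  rows_cov : ∀ i j k, covariance (fun ω => A ω i j) (fun ω => A ω i k) P = SigA j k
  rows_subGaussian : ∀ i, ∀ u : Fin p → ℝ, l2norm u = 1 →
    HasSubgaussianMGF (fun ω => ∑ j, u j * A ω i j) (τ ^ 2) P
  noise_indep : iIndepFun (fun (i : Fin n) (ω : Ω) => ε ω i) P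
  noise_identDistrib : ∀ i i' : Fin n, IdentDistrib (fun ω => ε ω i) (fun ω => ε ω i') P P
  noise_subGaussian : ∀ i, HasSubgaussianMGF (fun ω => ε ω i) (σ ^ 2) P
  indep : IndepFun (fun (ω : Ω) (i : Fin n) (j : Fin p) => A ω i j) ε P

/-- The unbiased surrogate `n⁻¹ Zᵀ Z - Σ_A` of `Σ`, from the corrupted design `Z`. -/
def surrogateSigma {n p : ℕ} (Z : Matrix (Fin n) (Fin p) ℝ)
    (SigA : Matrix (Fin p) (Fin p) ℝ) : Matrix (Fin p) (Fin p) ℝ :=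
  gram Z - SigA

/-- The unbiased surrogate `n⁻¹ Zᵀ y` of `ξ = n⁻¹ Xᵀ y`. -/
def surrogateXi {n p : ℕ} (Z : Matrix (Fin n) (Fin p) ℝ) (y : Fin n → ℝ) : Fin p → ℝ :=
  (1 / (n : ℝ)) • (Zᵀ *ᵥ y)

/-- The calibrated design `√n P Diag(√max(θ₁, e), …, √max(θ_p, e)) Pᵀ`, where
`M = P Diag(θ₁, …, θ_p) Pᵀ` is an eigenvalue decomposition of the symmetric matrix `M`;
`cfc f M` is `P Diag(f θ₁, …, f θ_p) Pᵀ`. -/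
def calibratedDesign {p : ℕ} (n : ℕ) (e : ℝ) (M : Matrix (Fin p) (Fin p) ℝ) :
    Matrix (Fin p) (Fin p) ℝ :=
  √(n : ℝ) • cfc (fun t : ℝ => √(max t e)) M

/-- The calibrated response `√n P Diag(1/√max(θ₁, e), …, 1/√max(θ_p, e)) Pᵀ ξ`. -/
def calibratedResponse {p : ℕ} (n : ℕ) (e : ℝ) (M : Matrix (Fin p) (Fin p) ℝ)
    (ξ : Fin p → ℝ) : Fin p → ℝ :=
  √(n : ℝ) • (cfc (fun t : ℝ => 1 / √(max t e)) M *ᵥ ξ)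

/-- The function `φ(t) = (a-1)/(a+1) t² + 2/(a+1) t`. -/
def phi (a t : ℝ) : ℝ := (a - 1) / (a + 1) * t ^ 2 + 2 / (a + 1) * t

/-- The weighted `ℓ₁`-regularized least squares objective
`(2n)⁻¹ ‖Z̃ b - ỹ‖² + lam ∑ⱼ (1 - wⱼ) |bⱼ|`. -/
def weightedObjective {p : ℕ} (n : ℕ) (Zt : Matrix (Fin p) (Fin p) ℝ) (yt : Fin p → ℝ)
    (lam : ℝ) (w b : Fin p → ℝ) : ℝ :=
  1 / (2 * (n : ℝ)) * l2norm (Zt *ᵥ b - yt) ^ 2 + lam * ∑ j, (1 - w j) * |b j|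

/-- The multi-stage convex relaxation algorithm: `(ρ, w, β)` are the penalty parameters, the
weights and the iterates of a run on the data `(Zt, yt)` with regularization parameter `lam`.
The iterates are `β 1, β 2, …`; the value `β 0` plays no role, and neither does the number of
iterations after which one decides to stop. -/
structure IsAlgorithmRun {p : ℕ} (n : ℕ) (Zt : Matrix (Fin p) (Fin p) ℝ) (yt : Fin p → ℝ)
    (a lam : ℝ) (ρ : ℕ → ℝ) (w β : ℕ → Fin p → ℝ) : Prop where
  lam_pos : 0 < lam
  w_init : ∀ j, w 0 j ∈ Set.Icc (0 : ℝ) (1 / 2)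
  ρ_init : ρ 0 = 1
  β_step : ∀ k : ℕ, 1 ≤ k → ∀ b : Fin p → ℝ,
    weightedObjective n Zt yt lam (w (k - 1)) (β k) ≤ weightedObjective n Zt yt lam (w (k - 1)) b
  ρ_step : ∀ k : ℕ, 1 ≤ k → k ≤ 3 → ρ (k - 1) ≤ ρ k
  ρ_const : ∀ k : ℕ, 3 < k → ρ k = ρ (k - 1)
  w_mem : ∀ k : ℕ, 1 ≤ k → ∀ j, w k j ∈ Set.Icc (0 : ℝ) 1
  w_step : ∀ k : ℕ, 1 ≤ k → ∀ j, ∀ t ∈ Set.Icc (0 : ℝ) 1,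
    phi a (w k j) - ρ k * w k j * |β k j| ≤ phi a t - ρ k * t * |β k j|

end

/-!
The data enter the algorithm only through `Σ̂ = ZᵀZ/n - Σ_A`, clipped to `Σ̃` with eigenvalues at
least `e`, and through `ξ̂ = Zᵀy/n`: each weighted problem minimizes
`b ↦ ½ bᵀ Σ̃ b - ξ̂ᵀ b + lam ∑ⱼ (1 - wⱼ) |bⱼ|` (`weightedObjective_calibrated`). Two properties of
this quadratic function suffice.

* `Σ̃` inherits the restricted eigenvalue condition with constant `κ / 2`. Clipping only increases
  the quadratic form, and `Σ̂ - Σ` is entrywise small, which on the restricted cone costs a multiple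
  of `s` times its largest entry.
* `‖ξ̂ - Σ̃ β*‖_∞ ≤ 2 (λ_max(Σ_A) + e) ‖β*‖₁`. Since `Σ̂ ⪰ -Σ_A`, clipping moves `Σ̂` by at most
  `λ_max(Σ_A) + e` in the Loewner order, hence entrywise; the remainder `ξ̂ - Σ̂ β*` is made of
  centred averages.

Given these, `IsAlgorithmRun.l2norm_sub_le` bounds all iterates by induction. At a minimizer the
basic inequality places the error in the restricted cone of any set `S` that contains the support
and all coordinates with weight above `1 / 2`, provided `|S| ≤ 1.5 s`, and the restricted eigenvalue
then bounds the error. A weight exceeds `1 / 2` only where the coefficient is at least `1 / ρ`, so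
the error bound of one step and the bound on `ρ` leave at most `s / 2` such coordinates off the
support in the next.

The random part is that the entries of `XᵀA/n`, `AᵀA/n - Σ_A`, `Xᵀε/n` and `Aᵀε/n` are all at most
a constant over `s`. The linear averages are sub-Gaussian. Products of sub-Gaussian variables have
an exponential moment, because squares do (`lintegral_exp_sq_le`), and Bernstein's inequality
applies to their averages. A union bound over the entries ends the proof.
-/

/-! ### Eigenvalue clipping and the calibrated objective -/

open scoped MatrixOrder in
/-- In the Loewner order, a real symmetric matrix is at most its largest eigenvalue. -/
lemma le_lamMax {p : ℕ} {M : Matrix (Fin p) (Fin p) ℝ} (hM : M.IsHermitian) :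
    M ≤ algebraMap ℝ _ (lamMax M) := by
  have hM' : IsSelfAdjoint M := hM
  refine le_algebraMap_of_spectrum_le (fun x hx => ?_)
  exact le_csSup (Matrix.finite_real_spectrum (A := M)).bddAbove hx

/-- The entries of a positive semidefinite matrix bounded by `c` in the Loewner order are at most
`c` in absolute value: test the quadratic form on `eⱼ ± eₖ`. -/
lemma abs_apply_le_of_posSemidef {p : ℕ} {D : Matrix (Fin p) (Fin p) ℝ} {c : ℝ}
    (hD : D.PosSemidef) (hc : (c • (1 : Matrix (Fin p) (Fin p) ℝ) - D).PosSemidef)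
    (j k : Fin p) : |D j k| ≤ c := by
  have hsym : ∀ i l, D i l = D l i := fun i l => by
    have := hD.1.apply l i
    simpa using this
  have hdiag : ∀ i, D i i ≤ c := fun i => by
    have := hc.diag_nonneg (i := i)
    simp at this
    linarith
  have hq : ∀ s : ℝ, 0 ≤ D j j + s * (D j k) + s * D k j + s * s * D k k := fun s => by
    have := hD.dotProduct_mulVec_nonneg (Pi.single j 1 + s • Pi.single k 1)
    simp [Matrix.mulVec_add, Matrix.mulVec_smul, dotProduct_add, add_dotProduct] at this
    linarith
  have h1 := hq 1
  have h2 := hq (-1)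
  have h3 := hsym j k
  have h4 := hdiag j
  have h5 := hdiag k
  rw [abs_le]
  constructor <;> nlinarith

/-- The Gram matrix of the calibrated design: eigenvalues of `M` below `e` are raised to `e`. -/
noncomputable def clippedMatrix {p : ℕ} (e : ℝ) (M : Matrix (Fin p) (Fin p) ℝ) :
    Matrix (Fin p) (Fin p) ℝ :=
  cfc (fun t : ℝ => max t e) M

lemma clippedMatrix_isHermitian {p : ℕ} (e : ℝ) (M : Matrix (Fin p) (Fin p) ℝ) :
    (clippedMatrix e M).IsHermitian :=
  cfc_predicate _ M

open scoped MatrixOrder in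
lemma clippedMatrix_sub_posSemidef {p : ℕ} (e : ℝ) {M : Matrix (Fin p) (Fin p) ℝ}
    (hM : M.IsHermitian) : (clippedMatrix e M - M).PosSemidef := by
  have hM' : IsSelfAdjoint M := hM
  have h : cfc (fun t : ℝ => t) M ≤ cfc (fun t : ℝ => max t e) M :=
    cfc_mono (fun x _ => le_max_left x e) (by fun_prop) (by fun_prop)
  rw [cfc_id' ℝ M] at h
  exact Matrix.le_iff.1 h

open scoped MatrixOrder in
/-- Clipping at `e` moves a matrix with eigenvalues at least `-l` by at most `l + e`. -/
lemma smul_one_sub_clippedMatrix_posSemidef {p : ℕ} {e l : ℝ} {M : Matrix (Fin p) (Fin p) ℝ}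
    (hM : M.IsHermitian) (hle : 0 ≤ l + e)
    (hl : (M + l • (1 : Matrix (Fin p) (Fin p) ℝ)).PosSemidef) :
    ((l + e) • (1 : Matrix (Fin p) (Fin p) ℝ) - (clippedMatrix e M - M)).PosSemidef := by
  have hM' : IsSelfAdjoint M := hM
  have hlow : algebraMap ℝ _ (-l) ≤ M := by
    rw [Matrix.le_iff, Algebra.algebraMap_eq_smul_one]
    rwa [neg_smul, sub_neg_eq_add]
  rw [algebraMap_le_iff_le_spectrum] at hlow
  have h : cfc (fun t : ℝ => max t e - t) M ≤ algebraMap ℝ _ (l + e) := by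
    refine cfc_le_algebraMap _ _ _ (fun x hx => ?_) (by fun_prop)
    have := hlow x hx
    rcases max_cases x e with h | h <;> linarith
  rw [cfc_sub (fun t : ℝ => max t e) (fun t => t) M (by fun_prop) (by fun_prop),
    cfc_id' ℝ M, Matrix.le_iff, Algebra.algebraMap_eq_smul_one] at h
  exact h

lemma cfc_sqrt_mul_self {p : ℕ} {e : ℝ} (he : 0 < e) (M : Matrix (Fin p) (Fin p) ℝ) :
    cfc (fun t : ℝ => √(max t e)) M * cfc (fun t : ℝ => √(max t e)) M = clippedMatrix e M := by
  rw [← cfc_mul _ _ M (by fun_prop) (by fun_prop), clippedMatrix]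
  congr 1
  ext t
  exact Real.mul_self_sqrt (he.le.trans (le_max_right _ _))

lemma cfc_sqrt_mul_inv_sqrt {p : ℕ} {e : ℝ} (he : 0 < e) {M : Matrix (Fin p) (Fin p) ℝ}
    (hM : M.IsHermitian) :
    cfc (fun t : ℝ => √(max t e)) M * cfc (fun t : ℝ => 1 / √(max t e)) M = 1 := by
  have hM' : IsSelfAdjoint M := hM
  have hpos : ∀ t, 0 < √(max t e) := fun t => Real.sqrt_pos.2 (he.trans_le (le_max_right _ _))
  have hcont : Continuous fun t : ℝ => 1 / √(max t e) :=
    Continuous.div (by fun_prop) (by fun_prop) fun t => (hpos t).ne'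
  rw [← cfc_mul _ _ M (by fun_prop) hcont.continuousOn]
  have : (fun x : ℝ => √(max x e) * (1 / √(max x e))) = fun _ => 1 := by
    ext t
    exact mul_one_div_cancel (hpos t).ne'
  rw [this, cfc_const_one ℝ M]

lemma l2norm_sq {p : ℕ} (b : Fin p → ℝ) : l2norm b ^ 2 = b ⬝ᵥ b := by
  rw [l2norm, EuclideanSpace.norm_sq_eq]
  simp [dotProduct, sq]

lemma l2norm_nonneg {p : ℕ} (b : Fin p → ℝ) : 0 ≤ l2norm b := norm_nonneg _

lemma l2norm_smul_of_nonneg {p : ℕ} {r : ℝ} (hr : 0 ≤ r) (b : Fin p → ℝ) :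
    l2norm (r • b) = r * l2norm b := by
  simp [l2norm, norm_smul, abs_of_nonneg hr]

/-- The data fit of the calibrated problem is, up to a constant in `b`, a quadratic function of
`b` in which the surrogates `clippedMatrix e M` and `ξ` replace `XᵀX/n` and `Xᵀy/n`. -/
lemma weightedObjective_calibrated {n p : ℕ} (hn : 0 < n) {e : ℝ} (he : 0 < e)
    {M : Matrix (Fin p) (Fin p) ℝ} (hM : M.IsHermitian) (ξ : Fin p → ℝ) (lam : ℝ)
    (w b : Fin p → ℝ) :
    weightedObjective n (calibratedDesign n e M) (calibratedResponse n e M ξ) lam w b =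
      1 / 2 * (b ⬝ᵥ (clippedMatrix e M *ᵥ b)) - ξ ⬝ᵥ b + lam * ∑ j, (1 - w j) * |b j|
        + 1 / 2 * l2norm (cfc (fun t : ℝ => 1 / √(max t e)) M *ᵥ ξ) ^ 2 := by
  have hn' : (0 : ℝ) < n := by exact_mod_cast hn
  set F := cfc (fun t : ℝ => √(max t e)) M with hF
  set G := cfc (fun t : ℝ => 1 / √(max t e)) M with hG
  have hFF : F * F = clippedMatrix e M := cfc_sqrt_mul_self he M
  have hFG : F * G = 1 := cfc_sqrt_mul_inv_sqrt he hM
  have hFt : Fᵀ = F := by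
    have : IsSelfAdjoint F := cfc_predicate _ M
    simpa [IsSelfAdjoint, Matrix.star_eq_conjTranspose] using this
  have h1 : calibratedDesign n e M *ᵥ b - calibratedResponse n e M ξ =
      √(n : ℝ) • (F *ᵥ b - G *ᵥ ξ) := by
    simp only [calibratedDesign, calibratedResponse, ← hF, ← hG, Matrix.smul_mulVec, smul_sub]
  have h2 : (F *ᵥ b) ⬝ᵥ (F *ᵥ b) = b ⬝ᵥ (clippedMatrix e M *ᵥ b) := by
    rw [← hFF, ← Matrix.mulVec_mulVec, Matrix.dotProduct_mulVec b, ← Matrix.mulVec_transpose, hFt]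
  have h3 : (F *ᵥ b) ⬝ᵥ (G *ᵥ ξ) = ξ ⬝ᵥ b := by
    have : F *ᵥ b = b ᵥ* F := by rw [← Matrix.mulVec_transpose, hFt]
    rw [this, ← Matrix.dotProduct_mulVec, Matrix.mulVec_mulVec, hFG, Matrix.one_mulVec,
      dotProduct_comm]
  rw [weightedObjective, h1, l2norm_smul_of_nonneg (Real.sqrt_nonneg _), mul_pow,
    Real.sq_sqrt hn'.le, l2norm_sq, l2norm_sq, sub_dotProduct, dotProduct_sub, dotProduct_sub,
    h2, dotProduct_comm (G *ᵥ ξ) (F *ᵥ b), h3]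
  field_simp
  ring

/-! ### The error bound for one weighted problem -/

/-- The basic inequality. A minimizer `b` of a weighted `ℓ₁`-penalized quadratic function is
compared with the points of the segment from `b` to `βs`; letting the step tend to zero keeps the
full curvature `u ⬝ᵥ (S *ᵥ u)`, of which a comparison with `βs` itself would keep half. -/
lemma basic_inequality {p : ℕ} {S : Matrix (Fin p) (Fin p) ℝ} (hS : S.IsHermitian)
    {ξ βs b w : Fin p → ℝ} {lam : ℝ} (hlam : 0 ≤ lam) (hw : ∀ j, w j ≤ 1)
    (hmin : ∀ b' : Fin p → ℝ,
      1 / 2 * (b ⬝ᵥ (S *ᵥ b)) - ξ ⬝ᵥ b + lam * ∑ j, (1 - w j) * |b j| ≤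
        1 / 2 * (b' ⬝ᵥ (S *ᵥ b')) - ξ ⬝ᵥ b' + lam * ∑ j, (1 - w j) * |b' j|) :
    (b - βs) ⬝ᵥ (S *ᵥ (b - βs)) ≤
      (ξ - S *ᵥ βs) ⬝ᵥ (b - βs) + lam * ∑ j, (1 - w j) * (|βs j| - |b j|) := by
  obtain ⟨u, rfl⟩ : ∃ u, b = βs + u := ⟨b - βs, by simp⟩
  rw [add_sub_cancel_left]
  set Q := u ⬝ᵥ (S *ᵥ u)
  set R := ∑ j, (1 - w j) * (|βs j| - |(βs + u) j|) with hR
  have hSt : Sᵀ = S := (by simpa using hS : S.IsSymm)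
  have hsym : ∀ x y : Fin p → ℝ, x ⬝ᵥ (S *ᵥ y) = y ⬝ᵥ (S *ᵥ x) := fun x y => by
    rw [Matrix.dotProduct_mulVec, ← Matrix.mulVec_transpose, hSt, dotProduct_comm]
  have key : ∀ t : ℝ, 0 < t → t ≤ 1 →
      Q ≤ (ξ - S *ᵥ βs) ⬝ᵥ u + lam * R + t * (1 / 2 * Q) := by
    intro t ht ht1
    have h := hmin (βs + u - t • u)
    have hpen : ∑ j, (1 - w j) * |(βs + u - t • u) j| ≤
        ∑ j, (1 - w j) * |(βs + u) j| + t * R := by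
      rw [hR, Finset.mul_sum, ← Finset.sum_add_distrib]
      refine Finset.sum_le_sum fun j _ => ?_
      have h1 : |(βs + u - t • u) j| ≤ t * |βs j| + (1 - t) * |(βs + u) j| := by
        have : (βs + u - t • u) j = t * βs j + (1 - t) * (βs + u) j := by
          simp; ring
        rw [this]
        refine (abs_add_le _ _).trans ?_
        rw [abs_mul, abs_mul, abs_of_pos ht, abs_of_nonneg (by linarith : 0 ≤ 1 - t)]
      have h2 := mul_le_mul_of_nonneg_left h1 (by linarith [hw j] : 0 ≤ 1 - w j)
      linarith
    have hpen' := mul_le_mul_of_nonneg_left hpen hlam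
    have e1 : (βs + u - t • u) ⬝ᵥ (S *ᵥ (βs + u - t • u)) =
        (βs + u) ⬝ᵥ (S *ᵥ (βs + u)) - 2 * t * (u ⬝ᵥ (S *ᵥ (βs + u))) + t ^ 2 * Q := by
      rw [Matrix.mulVec_sub, dotProduct_sub, sub_dotProduct, sub_dotProduct,
        Matrix.mulVec_smul, dotProduct_smul, smul_dotProduct, dotProduct_smul, smul_dotProduct,
        hsym (βs + u) u]
      simp only [smul_eq_mul]
      ring
    have e2 : u ⬝ᵥ (S *ᵥ (βs + u)) = (S *ᵥ βs) ⬝ᵥ u + Q := by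
      rw [Matrix.mulVec_add, dotProduct_add, dotProduct_comm u (S *ᵥ βs)]
    have e3 : ξ ⬝ᵥ (βs + u - t • u) = ξ ⬝ᵥ (βs + u) - t * (ξ ⬝ᵥ u) := by
      rw [dotProduct_sub, dotProduct_smul, smul_eq_mul]
    rw [e1, e2, e3] at h
    rw [sub_dotProduct]
    refine le_of_mul_le_mul_left ?_ ht
    nlinarith
  refine le_of_forall_pos_le_add fun δ hδ => ?_
  set t := min 1 (δ / (|1 / 2 * Q| + 1)) with ht
  have hpos : 0 < |1 / 2 * Q| + 1 := by positivity
  have ht0 : 0 < t := lt_min one_pos (by positivity)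
  have h := key t ht0 (min_le_left _ _)
  have h2 : t * (1 / 2 * Q) ≤ δ := by
    have h3 : t ≤ δ / (|1 / 2 * Q| + 1) := min_le_right _ _
    rw [le_div_iff₀ hpos] at h3
    nlinarith [le_abs_self (1 / 2 * Q)]
  linarith

/-- Cauchy–Schwarz on a coordinate set. -/
lemma sq_sum_abs_le {p : ℕ} (S : Finset (Fin p)) (b : Fin p → ℝ) :
    (∑ j ∈ S, |b j|) ^ 2 ≤ S.card * l2norm b ^ 2 := by
  rw [l2norm_sq]
  refine sq_sum_le_card_mul_sum_sq.trans ?_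
  gcongr
  simp only [sq_abs, dotProduct, ← sq]
  exact Finset.sum_le_univ_sum_of_nonneg fun j => sq_nonneg _

lemma abs_dotProduct_mulVec_le {p : ℕ} {D : Matrix (Fin p) (Fin p) ℝ} {δ : ℝ}
    (hD : ∀ j k, |D j k| ≤ δ) (b : Fin p → ℝ) :
    |b ⬝ᵥ (D *ᵥ b)| ≤ δ * (l1norm b) ^ 2 := by
  simp only [dotProduct, Matrix.mulVec, l1norm, sq]
  rw [Finset.sum_mul_sum, Finset.mul_sum]
  refine (Finset.abs_sum_le_sum_abs _ _).trans (Finset.sum_le_sum fun j _ => ?_)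
  rw [Finset.mul_sum, Finset.mul_sum]
  refine (Finset.abs_sum_le_sum_abs _ _).trans (Finset.sum_le_sum fun k _ => ?_)
  rw [abs_mul, abs_mul]
  nlinarith [hD j k, mul_nonneg (abs_nonneg (b j)) (abs_nonneg (b k))]

lemma abs_mulVec_le {p : ℕ} {D : Matrix (Fin p) (Fin p) ℝ} {δ : ℝ}
    (hD : ∀ j k, |D j k| ≤ δ) (b : Fin p → ℝ) (j : Fin p) :
    |(D *ᵥ b) j| ≤ δ * l1norm b := by
  simp only [Matrix.mulVec, dotProduct, l1norm]
  rw [Finset.mul_sum]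
  refine (Finset.abs_sum_le_sum_abs _ _).trans (Finset.sum_le_sum fun k _ => ?_)
  rw [abs_mul]
  gcongr
  exact hD j k

/-- On the restricted cone `‖b‖₁² ≤ 24 s ‖b‖²`, so an entrywise perturbation of size
`κ / (48 s)` costs at most half of the restricted eigenvalue. -/
lemma RestrictedEigenvalue.half_of_perturbation {p : ℕ} {M D : Matrix (Fin p) (Fin p) ℝ}
    {T : Finset (Fin p)} {κ δ : ℝ} (h : RestrictedEigenvalue M T κ)
    (hD : ∀ j k, |D j k| ≤ δ) (hδ0 : 0 ≤ δ) (hδ : 48 * T.card * δ ≤ κ) :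
    RestrictedEigenvalue (M + D) T (κ / 2) := by
  refine ⟨half_pos h.1, fun b hb => ?_⟩
  have h1 := h.2 b hb
  obtain ⟨S, -, hcard, hS⟩ := hb
  have h2 := abs_dotProduct_mulVec_le hD b
  have h3 : l1norm b ≤ 4 * ∑ j ∈ S, |b j| := by
    have : l1norm b = ∑ j ∈ S, |b j| + ∑ j ∈ Sᶜ, |b j| := (Finset.sum_add_sum_compl S _).symm
    linarith
  have h4 : (l1norm b) ^ 2 ≤ 24 * T.card * l2norm b ^ 2 := by
    have h0 : 0 ≤ l1norm b := Finset.sum_nonneg fun j _ => abs_nonneg _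
    calc (l1norm b) ^ 2 ≤ (4 * ∑ j ∈ S, |b j|) ^ 2 := by gcongr
      _ = 16 * (∑ j ∈ S, |b j|) ^ 2 := by ring
      _ ≤ 16 * (S.card * l2norm b ^ 2) := by gcongr; exact sq_sum_abs_le S b
      _ ≤ 16 * (3 / 2 * T.card * l2norm b ^ 2) := by gcongr
      _ = _ := by ring
  rw [Matrix.add_mulVec, dotProduct_add]
  have h5 := mul_le_mul_of_nonneg_left h4 hδ0
  have h6 := mul_le_mul_of_nonneg_right hδ (sq_nonneg (l2norm b))
  have h7 := (abs_le.1 h2).1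
  linarith

/-- The error bound for one weighted `ℓ₁` problem: the weights may exempt any coordinates of a set
`S ⊇ S*` with `|S| ≤ 1.5 s` from penalization, as long as those outside `S` keep half of it. -/
lemma l2norm_sub_le_of_basic_inequality {p : ℕ} {M : Matrix (Fin p) (Fin p) ℝ}
    {ξ βs b w : Fin p → ℝ} {lam κ : ℝ} (hlam : 0 < lam)
    (hM : M.PosSemidef) (hRE : RestrictedEigenvalue M (suppSet βs) (κ / 2))
    {S : Finset (Fin p)} (hsub : suppSet βs ⊆ S)
    (hcard : (S.card : ℝ) ≤ 3 / 2 * ((suppSet βs).card : ℝ))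
    (hw : ∀ j, w j ∈ Set.Icc (0 : ℝ) 1) (hwS : ∀ j, j ∉ S → w j ≤ 1 / 2)
    (hξ : ∀ j, |(ξ - M *ᵥ βs) j| ≤ lam / 8)
    (hbasic : (b - βs) ⬝ᵥ (M *ᵥ (b - βs)) ≤
      (ξ - M *ᵥ βs) ⬝ᵥ (b - βs) + lam * ∑ j, (1 - w j) * (|βs j| - |b j|)) :
    l2norm (b - βs) ≤ 4 * √((suppSet βs).card : ℝ) * lam / κ := by
  set u := b - βs with hu
  set s : ℝ := ((suppSet βs).card : ℝ) with hs
  have hκ : 0 < κ := by linarith [hRE.1]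
  have hsplit : (ξ - M *ᵥ βs) ⬝ᵥ u + lam * ∑ j, (1 - w j) * (|βs j| - |b j|) ≤
      9 / 8 * lam * ∑ j ∈ S, |u j| - 3 / 8 * lam * ∑ j ∈ Sᶜ, |u j| := by
    rw [dotProduct, Finset.mul_sum, ← Finset.sum_add_distrib, ← Finset.sum_add_sum_compl S,
      Finset.mul_sum, Finset.mul_sum, sub_eq_add_neg (∑ j ∈ S, 9 / 8 * lam * |u j|), ← Finset.sum_neg_distrib]
    have hnoise : ∀ j, (ξ - M *ᵥ βs) j * u j ≤ lam / 8 * |u j| := fun j =>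
      (le_abs_self _).trans (by rw [abs_mul]; gcongr; exact hξ j)
    refine add_le_add (Finset.sum_le_sum fun j _ => ?_) (Finset.sum_le_sum fun j hj => ?_)
    · have h1 : |βs j| - |b j| ≤ |u j| := by
        have := abs_sub_abs_le_abs_sub (βs j) (b j)
        rwa [abs_sub_comm] at this
      have h2 : (1 - w j) * (|βs j| - |b j|) ≤ |u j| := by
        have := hw j
        calc (1 - w j) * (|βs j| - |b j|) ≤ (1 - w j) * |u j| := by
              gcongr
              linarith [this.2]
          _ ≤ 1 * |u j| := by
              gcongr
              linarith [this.1]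
          _ = |u j| := one_mul _
      have := mul_le_mul_of_nonneg_left h2 hlam.le
      linarith [hnoise j]
    · have hjS : j ∉ S := Finset.mem_compl.1 hj
      have hβ : βs j = 0 := by
        by_contra h
        exact hjS (hsub (by simpa [suppSet] using h))
      have hub : u j = b j := by simp [hu, hβ]
      have h1 := mul_le_mul_of_nonneg_right (hwS j hjS) (abs_nonneg (b j))
      have h2 : (1 - w j) * (|βs j| - |b j|) ≤ - (1 / 2 * |u j|) := by
        rw [hub, hβ, abs_zero]
        linarith
      have := mul_le_mul_of_nonneg_left h2 hlam.le
      linarith [hnoise j]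
  have hQ : 0 ≤ u ⬝ᵥ (M *ᵥ u) := by simpa using hM.dotProduct_mulVec_nonneg u
  set a := ∑ j ∈ S, |u j| with ha
  have ha0 : 0 ≤ a := Finset.sum_nonneg fun j _ => abs_nonneg _
  have hc0 : 0 ≤ ∑ j ∈ Sᶜ, |u j| := Finset.sum_nonneg fun j _ => abs_nonneg _
  have hcone : u ∈ restrictedCone (suppSet βs) := by
    refine ⟨S, hsub, hcard, ?_⟩
    refine le_of_mul_le_mul_left ?_ (by positivity : 0 < 3 / 8 * lam)
    linarith
  have h1 : κ * l2norm u ^ 2 ≤ 9 / 4 * lam * a := by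
    have := hRE.2 u hcone
    have := mul_nonneg hlam.le hc0
    linarith
  have h2 : a ^ 2 ≤ 3 / 2 * s * l2norm u ^ 2 :=
    (sq_sum_abs_le S u).trans (by gcongr)
  rw [le_div_iff₀ hκ]
  set N := l2norm u
  have hN : 0 ≤ N := l2norm_nonneg u
  rcases hN.eq_or_lt with hN0 | hN0
  · rw [← hN0, zero_mul]
    positivity
  have hs0 : 0 ≤ s := Nat.cast_nonneg _
  refine abs_le_of_sq_le_sq' ?_ (by positivity) |>.2
  rw [mul_pow, mul_pow, mul_pow, Real.sq_sqrt hs0]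
  have h3 : (κ * N ^ 2) ^ 2 ≤ (9 / 4 * lam * a) ^ 2 := by gcongr
  have h4 : (9 / 4 * lam * a) ^ 2 ≤ 81 / 16 * lam ^ 2 * (3 / 2 * s * N ^ 2) := by
    rw [mul_pow, mul_pow]
    have := mul_le_mul_of_nonneg_left h2 (by positivity : 0 ≤ 81 / 16 * lam ^ 2)
    linarith
  refine le_of_mul_le_mul_right ?_ (by positivity : 0 < N ^ 2)
  have : 0 ≤ s * lam ^ 2 * N ^ 2 := by positivity
  linarith

/-! ### The weights and the induction along a run -/

/-- Since `φ` has slope `1` at `1 / 2`, whatever `a` is, a weight exceeds `1 / 2` only where the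
coefficient is at least `1 / ρ`. -/
lemma one_le_mul_of_half_lt_weight {a r x w : ℝ} (ha : 1 < a) (hw : 1 / 2 < w)
    (hmin : phi a w - r * w * x ≤ phi a (1 / 2) - r * (1 / 2) * x) : 1 ≤ r * x := by
  have ha1 : 0 < a + 1 := by linarith
  have hphi : phi a w - phi a (1 / 2) =
      (w - 1 / 2) * (1 + (a - 1) / (a + 1) * (w - 1 / 2)) := by
    unfold phi
    field_simp
    ring
  have h1 : 0 ≤ (a - 1) / (a + 1) * (w - 1 / 2) :=
    mul_nonneg (div_nonneg (by linarith) ha1.le) (by linarith)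
  have h2 : (w - 1 / 2) * (1 + (a - 1) / (a + 1) * (w - 1 / 2)) ≤ (w - 1 / 2) * (r * x) := by
    rw [← hphi]
    linarith
  have h3 := le_of_mul_le_mul_left h2 (by linarith)
  linarith

/-- Coordinates off the support whose coefficients are at least `1 / ρ` are errors of at least
that size, so an `ℓ₂` error bound limits their number. -/
lemma card_union_le {p : ℕ} {βs b w : Fin p → ℝ} {r κ lam : ℝ} (hκ : 0 < κ) (hlam : 0 < lam)
    (hr : r ≤ κ / (4 * √2 * lam))
    (hw : ∀ j, 1 / 2 < w j → 1 ≤ r * |b j|) (hr0 : 0 < r)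
    (herr : l2norm (b - βs) ≤ 4 * √((suppSet βs).card : ℝ) * lam / κ) :
    ((suppSet βs ∪ Finset.univ.filter fun j => 1 / 2 < w j).card : ℝ) ≤
      3 / 2 * ((suppSet βs).card : ℝ) := by
  set s : ℝ := ((suppSet βs).card : ℝ) with hs
  have hs0 : 0 ≤ s := Nat.cast_nonneg _
  set W := (Finset.univ.filter fun j => 1 / 2 < w j) \ suppSet βs with hW
  have hcard : ((suppSet βs ∪ Finset.univ.filter fun j => 1 / 2 < w j).card : ℝ) = s + W.card := by
    rw [← Finset.union_sdiff_self_eq_union, Finset.card_union_of_disjoint Finset.disjoint_sdiff]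
    push_cast
    rfl
  have h1 : (W.card : ℝ) ≤ r ^ 2 * l2norm (b - βs) ^ 2 := by
    rw [l2norm_sq, dotProduct, Finset.mul_sum]
    calc (W.card : ℝ) = ∑ j ∈ W, (1 : ℝ) := by simp
      _ ≤ ∑ j ∈ W, r ^ 2 * ((b - βs) j * (b - βs) j) := by
          refine Finset.sum_le_sum fun j hj => ?_
          simp only [hW, Finset.mem_sdiff, Finset.mem_filter, Finset.mem_univ, true_and,
            suppSet, not_not] at hj
          have h := hw j hj.1
          have h' : (b - βs) j = b j := by simp [hj.2]
          rw [h']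
          have : r ^ 2 * (b j * b j) = (r * |b j|) ^ 2 := by
            rw [mul_pow, sq_abs]; ring
          rw [this]
          exact one_le_pow₀ h
      _ ≤ _ := Finset.sum_le_univ_sum_of_nonneg fun j =>
          mul_nonneg (sq_nonneg _) (mul_self_nonneg _)
  have h2 : r * l2norm (b - βs) ≤
      κ / (4 * √2 * lam) * (4 * √s * lam / κ) := by
    gcongr
    exact l2norm_nonneg _
  have h3 : κ / (4 * √2 * lam) * (4 * √s * lam / κ) = √s / √2 := by
    field_simp
  have h4 : (r * l2norm (b - βs)) ^ 2 ≤ s / 2 := by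
    rw [h3] at h2
    calc (r * l2norm (b - βs)) ^ 2 ≤ (√s / √2) ^ 2 := by
          have := l2norm_nonneg (b - βs)
          gcongr
      _ = s / 2 := by rw [div_pow, Real.sq_sqrt hs0, Real.sq_sqrt (by norm_num)]
  rw [hcard]
  rw [mul_pow] at h4
  linarith

lemma IsAlgorithmRun.one_le_ρ {p n : ℕ} {Zt : Matrix (Fin p) (Fin p) ℝ} {yt : Fin p → ℝ}
    {a lam : ℝ} {ρ : ℕ → ℝ} {w β : ℕ → Fin p → ℝ} (h : IsAlgorithmRun n Zt yt a lam ρ w β)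
    (k : ℕ) : 1 ≤ ρ k := by
  induction k with
  | zero => exact h.ρ_init.ge
  | succ k ih =>
    rcases le_or_gt (k + 1) 3 with hk | hk
    · exact ih.trans (h.ρ_step (k + 1) (by omega) hk)
    · exact ih.trans (h.ρ_const (k + 1) hk).ge

lemma IsAlgorithmRun.ρ_le {p n : ℕ} {Zt : Matrix (Fin p) (Fin p) ℝ} {yt : Fin p → ℝ}
    {a lam : ℝ} {ρ : ℕ → ℝ} {w β : ℕ → Fin p → ℝ} (h : IsAlgorithmRun n Zt yt a lam ρ w β)
    (k : ℕ) : ρ k ≤ ρ 3 := by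
  rcases le_or_gt k 3 with hk | hk
  · have h1 := h.ρ_step 1 le_rfl (by norm_num)
    have h2 := h.ρ_step 2 (by norm_num) (by norm_num)
    have h3 := h.ρ_step 3 (by norm_num) le_rfl
    norm_num at h1 h2 h3
    interval_cases k <;> linarith
  · induction k, hk using Nat.le_induction with
    | base => exact (h.ρ_const 4 (by norm_num)).le
    | succ k hk ih => exact (h.ρ_const (k + 1) (by omega)).le.trans ih

/-- The deterministic guarantee: if the clipped surrogate satisfies the restricted eigenvalue
condition with `κ / 2` and `βs` is nearly stationary for the surrogate loss, then every iterate is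
within the stated distance. The induction alternates between the two bounds: a small error leaves
few coordinates off the support unpenalized, and few such coordinates keep the error small. -/
theorem IsAlgorithmRun.l2norm_sub_le {p n : ℕ} (hn : 0 < n) {e : ℝ} (he : 0 < e)
    {M : Matrix (Fin p) (Fin p) ℝ} (hM : M.IsHermitian) {ξ βs : Fin p → ℝ}
    {a lam κ : ℝ} {ρ : ℕ → ℝ} {w β : ℕ → Fin p → ℝ} (ha : 1 < a)
    (hrun : IsAlgorithmRun n (calibratedDesign n e M) (calibratedResponse n e M ξ) a lam ρ w β)
    (hPSD : (clippedMatrix e M).PosSemidef)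
    (hRE : RestrictedEigenvalue (clippedMatrix e M) (suppSet βs) (κ / 2))
    (hξ : ∀ j, |(ξ - clippedMatrix e M *ᵥ βs) j| ≤ lam / 8)
    (hρ : ρ 3 ≤ κ / (4 * √2 * lam)) (k : ℕ) (hk : 1 ≤ k) :
    l2norm (β k - βs) ≤ 4 * √((suppSet βs).card : ℝ) * lam / κ := by
  have hκ : 0 < κ := by linarith [hRE.1]
  have hw : ∀ k j, w k j ∈ Set.Icc (0 : ℝ) 1 := fun k j => by
    rcases Nat.eq_zero_or_pos k with rfl | hk
    · exact ⟨(hrun.w_init j).1, (hrun.w_init j).2.trans (by norm_num)⟩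
    · exact hrun.w_mem k hk j
  have hstep : ∀ (k : ℕ) (S : Finset (Fin p)), suppSet βs ⊆ S →
      (S.card : ℝ) ≤ 3 / 2 * ((suppSet βs).card : ℝ) → (∀ j, j ∉ S → w k j ≤ 1 / 2) →
      l2norm (β (k + 1) - βs) ≤ 4 * √((suppSet βs).card : ℝ) * lam / κ := by
    intro k S hsub hcard hwS
    refine l2norm_sub_le_of_basic_inequality hrun.lam_pos hPSD hRE hsub hcard (hw k) hwS hξ
      (basic_inequality (clippedMatrix_isHermitian e M) hrun.lam_pos.le (fun j => (hw k j).2)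
        fun b' => ?_)
    have h := hrun.β_step (k + 1) (by omega) b'
    rw [weightedObjective_calibrated hn he hM, weightedObjective_calibrated hn he hM] at h
    rw [Nat.add_sub_cancel] at h
    linarith
  induction k, hk using Nat.le_induction with
  | base =>
    refine hstep 0 (suppSet βs) subset_rfl ?_ fun j _ => (hrun.w_init j).2
    linarith [(Nat.cast_nonneg (suppSet βs).card : (0 : ℝ) ≤ _)]
  | succ k hk ih =>
    refine hstep k (suppSet βs ∪ Finset.univ.filter fun j => 1 / 2 < w k j)
      Finset.subset_union_left ?_ fun j hj => ?_
    · refine card_union_le hκ hrun.lam_pos ((hrun.ρ_le k).trans hρ) (fun j hj => ?_)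
        (one_pos.trans_le (hrun.one_le_ρ k)) ih
      exact one_le_mul_of_half_lt_weight ha hj
        (hrun.w_step k hk j (1 / 2) ⟨by norm_num, by norm_num⟩)
    · simp only [Finset.mem_union, Finset.mem_filter, Finset.mem_univ, true_and, not_or,
        not_lt] at hj
      exact hj.2

/-! ### Concentration of averages of sub-Gaussian variables and of their products -/

lemma hasSubgaussianMGF_mono {Ω : Type*} [MeasurableSpace Ω] {P : Measure Ω} {Y : Ω → ℝ}
    {v v' : ℝ≥0} (h : HasSubgaussianMGF Y v P) (hv : v ≤ v') : HasSubgaussianMGF Y v' P where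
  integrable_exp_mul := h.integrable_exp_mul
  mgf_le t := (h.mgf_le t).trans (by gcongr)

lemma lintegral_exp_sq_gaussianReal :
    ∫⁻ g, ENNReal.ofReal (Real.exp (g ^ 2 / 4)) ∂(gaussianReal 0 1) ≤ ENNReal.ofReal 2 := by
  rw [gaussianReal_of_var_ne_zero 0 one_ne_zero,
    lintegral_withDensity_eq_lintegral_mul _ (measurable_gaussianPDF 0 1) (by fun_prop)]
  have h : ∀ g : ℝ, (gaussianPDF 0 1 * fun g => ENNReal.ofReal (Real.exp (g ^ 2 / 4))) g =
      ENNReal.ofReal ((√(2 * Real.pi))⁻¹ * Real.exp (-(1 / 4) * g ^ 2)) := fun g => by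
    rw [Pi.mul_apply, gaussianPDF, ← ENNReal.ofReal_mul (gaussianPDFReal_nonneg _ _ _),
      gaussianPDFReal, mul_assoc, ← Real.exp_add]
    congr 3
    · simp
    · simp
      ring
  simp_rw [h]
  rw [← ofReal_integral_eq_lintegral_ofReal
    ((integrable_exp_neg_mul_sq (by norm_num)).const_mul _)
    (ae_of_all _ fun g => by positivity), integral_const_mul, integral_gaussian]
  refine ENNReal.ofReal_le_ofReal ?_
  rw [← Real.sqrt_inv, ← Real.sqrt_mul (by positivity)]
  refine Real.sqrt_le_iff.2 ⟨by norm_num, ?_⟩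
  have := Real.pi_pos
  field_simp
  norm_num

/-- The square of a sub-Gaussian variable has an exponential moment. Write
`exp (Y² / (4v)) = 𝔼 exp (g Y / √(2v))` with `g` standard Gaussian, exchange the expectations and
apply the sub-Gaussian bound for fixed `g`, which leaves `𝔼 exp (g² / 4) = √2`. -/
lemma lintegral_exp_sq_le {Ω : Type*} [MeasurableSpace Ω] {P : Measure Ω} [IsProbabilityMeasure P]
    {Y : Ω → ℝ} {v : ℝ≥0} (hv : 0 < v) (hY : Measurable Y) (h : HasSubgaussianMGF Y v P) :
    ∫⁻ ω, ENNReal.ofReal (Real.exp (Y ω ^ 2 / (4 * v))) ∂P ≤ ENNReal.ofReal 2 := by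
  have hv' : (0 : ℝ) < v := hv
  have hsq : √(2 * (v : ℝ)) ^ 2 = 2 * v := Real.sq_sqrt (by positivity)
  have hs : 0 < √(2 * (v : ℝ)) := Real.sqrt_pos.2 (by positivity)
  have h1 : ∀ ω, ENNReal.ofReal (Real.exp (Y ω ^ 2 / (4 * v))) =
      ∫⁻ g, ENNReal.ofReal (Real.exp (Y ω / √(2 * (v : ℝ)) * g)) ∂(gaussianReal 0 1) := fun ω => by
    rw [← ofReal_integral_eq_lintegral_ofReal (integrable_exp_mul_gaussianReal _)
      (ae_of_all _ fun g => (Real.exp_pos _).le)]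
    have := congrFun (mgf_id_gaussianReal (μ := 0) (v := 1)) (Y ω / √(2 * (v : ℝ)))
    simp only [mgf, id] at this
    rw [this, div_pow, hsq]
    congr 2
    push_cast
    field_simp
    ring
  simp_rw [h1]
  rw [lintegral_lintegral_swap (by fun_prop)]
  refine (lintegral_mono fun g => ?_).trans lintegral_exp_sq_gaussianReal
  have h2 := h.integrable_exp_mul (g / √(2 * (v : ℝ)))
  have h3 := h.mgf_le (g / √(2 * (v : ℝ)))
  have h4 : ∀ ω, Y ω / √(2 * (v : ℝ)) * g = g / √(2 * (v : ℝ)) * Y ω := fun ω => by ring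
  simp_rw [h4]
  rw [← ofReal_integral_eq_lintegral_ofReal h2 (ae_of_all _ fun g => (Real.exp_pos _).le)]
  refine ENNReal.ofReal_le_ofReal (h3.trans_eq ?_)
  rw [div_pow, hsq]
  congr 1
  field_simp
  norm_num

lemma integrable_exp_sq {Ω : Type*} [MeasurableSpace Ω] {P : Measure Ω} [IsProbabilityMeasure P]
    {Y : Ω → ℝ} {v : ℝ≥0} (hv : 0 < v) (hY : Measurable Y) (h : HasSubgaussianMGF Y v P) :
    Integrable (fun ω => Real.exp (Y ω ^ 2 / (4 * v))) P :=
  ⟨by fun_prop, (hasFiniteIntegral_iff_ofReal (ae_of_all _ fun g => (Real.exp_pos _).le)).2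
    ((lintegral_exp_sq_le hv hY h).trans_lt ENNReal.ofReal_lt_top)⟩

lemma integral_exp_sq_le {Ω : Type*} [MeasurableSpace Ω] {P : Measure Ω} [IsProbabilityMeasure P]
    {Y : Ω → ℝ} {v : ℝ≥0} (hv : 0 < v) (hY : Measurable Y) (h : HasSubgaussianMGF Y v P) :
    ∫ ω, Real.exp (Y ω ^ 2 / (4 * v)) ∂P ≤ 2 := by
  have h1 := lintegral_exp_sq_le hv hY h
  rw [← ofReal_integral_eq_lintegral_ofReal (integrable_exp_sq hv hY h)
    (ae_of_all _ fun g => (Real.exp_pos _).le)] at h1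
  exact (ENNReal.ofReal_le_ofReal_iff (by norm_num)).1 h1

lemma exp_abs_mul_div_le {y z v : ℝ} (hv : 0 < v) :
    Real.exp (|y * z| / v) ≤ 1 / 2 * Real.exp (y ^ 2 / v) + 1 / 2 * Real.exp (z ^ 2 / v) := by
  have h1 : |y * z| / v ≤ y ^ 2 / v / 2 + z ^ 2 / v / 2 := by
    rw [abs_mul, ← sq_abs y, ← sq_abs z]
    field_simp
    nlinarith [sq_nonneg (|y| - |z|)]
  have hsq : ∀ x : ℝ, Real.exp x = Real.exp (x / 2) ^ 2 := fun x => by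
    rw [← Real.exp_nat_mul]; congr 1; push_cast; ring
  refine (Real.exp_le_exp.2 h1).trans ?_
  rw [Real.exp_add, hsq (y ^ 2 / v), hsq (z ^ 2 / v)]
  nlinarith [sq_nonneg (Real.exp (y ^ 2 / v / 2) - Real.exp (z ^ 2 / v / 2))]

lemma integrable_exp_abs_mul {Ω : Type*} [MeasurableSpace Ω] {P : Measure Ω}
    [IsProbabilityMeasure P] {Y Z : Ω → ℝ} {v : ℝ≥0} (hv : 0 < v) (hY : Measurable Y)
    (hZ : Measurable Z) (hsY : HasSubgaussianMGF Y v P) (hsZ : HasSubgaussianMGF Z v P) :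
    Integrable (fun ω => Real.exp (|Y ω * Z ω| / (4 * v))) P := by
  refine Integrable.mono' (((integrable_exp_sq hv hY hsY).const_mul (1 / 2)).add
    ((integrable_exp_sq hv hZ hsZ).const_mul (1 / 2))) (by fun_prop) (ae_of_all _ fun ω => ?_)
  rw [Real.norm_of_nonneg (Real.exp_pos _).le]
  exact exp_abs_mul_div_le (by positivity)

lemma integral_exp_abs_mul_le {Ω : Type*} [MeasurableSpace Ω] {P : Measure Ω}
    [IsProbabilityMeasure P] {Y Z : Ω → ℝ} {v : ℝ≥0} (hv : 0 < v) (hY : Measurable Y)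
    (hZ : Measurable Z) (hsY : HasSubgaussianMGF Y v P) (hsZ : HasSubgaussianMGF Z v P) :
    ∫ ω, Real.exp (|Y ω * Z ω| / (4 * v)) ∂P ≤ 2 := by
  have hY2 := (integrable_exp_sq hv hY hsY).const_mul (1 / 2)
  have hZ2 := (integrable_exp_sq hv hZ hsZ).const_mul (1 / 2)
  refine (integral_mono (integrable_exp_abs_mul hv hY hZ hsY hsZ) (hY2.add hZ2)
    fun ω => exp_abs_mul_div_le (by positivity)).trans ?_
  simp only [Pi.add_apply]
  rw [integral_add hY2 hZ2, integral_const_mul, integral_const_mul]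
  linarith [integral_exp_sq_le hv hY hsY, integral_exp_sq_le hv hZ hsZ]

lemma abs_exp_sub_one_sub_le (x : ℝ) : |Real.exp x - 1 - x| ≤ x ^ 2 * Real.exp |x| := by
  have h := Complex.norm_exp_sub_sum_le_norm_mul_exp (x : ℂ) 2
  have h2 : Complex.exp x - ∑ m ∈ Finset.range 2, (x : ℂ) ^ m / (m.factorial : ℂ) =
      ((Real.exp x - 1 - x : ℝ) : ℂ) := by
    simp [Finset.sum_range_succ]
    ring
  rwa [h2, Complex.norm_real, Complex.norm_real, Real.norm_eq_abs, Real.norm_eq_abs,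
    sq_abs] at h

lemma sq_le_eight_mul_exp {y : ℝ} (hy : 0 ≤ y) : y ^ 2 ≤ 8 * Real.exp (y / 2) := by
  have := Real.quadratic_le_exp_of_nonneg (by linarith : 0 ≤ y / 2)
  nlinarith

/-- Bernstein's bound on the moment generating function near the origin, from one exponential
moment: `exp x ≤ 1 + x + x² exp |x|`, and half of the exponential moment absorbs `x²`. -/
lemma integral_exp_mul_le {Ω : Type*} [MeasurableSpace Ω] {P : Measure Ω}
    [IsProbabilityMeasure P] {W : Ω → ℝ} {b t : ℝ} (hb : 0 < b) (hW : Measurable W)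
    (hint : Integrable (fun ω => Real.exp (|W ω| / b)) P)
    (hbd : ∫ ω, Real.exp (|W ω| / b) ∂P ≤ 2) (ht : |t| * (2 * b) ≤ 1) :
    Integrable (fun ω => Real.exp (t * W ω)) P ∧
      ∫ ω, Real.exp (t * W ω) ∂P ≤ Real.exp (t * ∫ ω, W ω ∂P + 16 * b ^ 2 * t ^ 2) := by
  have hexp : ∀ ω, |t * W ω| ≤ |W ω| / b / 2 := fun ω => by
    rw [abs_mul, div_div, le_div_iff₀ (by positivity)]
    nlinarith [abs_nonneg (W ω)]
  have hI1 : Integrable (fun ω => Real.exp (t * W ω)) P := by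
    refine hint.mono' (by fun_prop) (ae_of_all _ fun ω => ?_)
    rw [Real.norm_of_nonneg (Real.exp_pos _).le, Real.exp_le_exp]
    have : 0 ≤ |W ω| / b := by positivity
    linarith [le_abs_self (t * W ω), hexp ω]
  have hI2 : Integrable W P := by
    refine (hint.const_mul b).mono' (by fun_prop) (ae_of_all _ fun ω => ?_)
    have := Real.add_one_le_exp (|W ω| / b)
    rw [Real.norm_eq_abs]
    calc |W ω| = b * (|W ω| / b) := by field_simp
      _ ≤ b * Real.exp (|W ω| / b) := by gcongr; linarith
  refine ⟨hI1, ?_⟩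
  have hpt : ∀ ω, Real.exp (t * W ω) ≤
      (1 + t * W ω) + 8 * b ^ 2 * t ^ 2 * Real.exp (|W ω| / b) := fun ω => by
    have h1 := (abs_le.1 (abs_exp_sub_one_sub_le (t * W ω))).2
    set y := |W ω| / b with hy
    have hy0 : 0 ≤ y := by positivity
    have h2 : (t * W ω) ^ 2 = b ^ 2 * t ^ 2 * y ^ 2 := by
      rw [hy, div_pow, sq_abs]; field_simp
    have h3 : Real.exp |t * W ω| ≤ Real.exp (y / 2) := Real.exp_le_exp.2 (hexp ω)
    have h4 : (t * W ω) ^ 2 * Real.exp |t * W ω| ≤ 8 * b ^ 2 * t ^ 2 * Real.exp y := by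
      calc (t * W ω) ^ 2 * Real.exp |t * W ω|
          ≤ b ^ 2 * t ^ 2 * (8 * Real.exp (y / 2)) * Real.exp (y / 2) := by
            rw [h2]; gcongr; exact sq_le_eight_mul_exp hy0
        _ = 8 * b ^ 2 * t ^ 2 * (Real.exp (y / 2) * Real.exp (y / 2)) := by ring
        _ = _ := by rw [← Real.exp_add, add_halves]
    linarith
  have hI3 : Integrable (fun ω => 1 + t * W ω) P := (integrable_const 1).add (hI2.const_mul t)
  have hI4 := hint.const_mul (8 * b ^ 2 * t ^ 2)
  have h := integral_mono hI1 (hI3.add hI4) hpt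
  simp only [Pi.add_apply] at h
  rw [integral_add hI3 hI4, integral_add (integrable_const 1) (hI2.const_mul t),
    integral_const_mul, integral_const_mul] at h
  simp only [integral_const, probReal_univ, smul_eq_mul, mul_one] at h
  have h5 := mul_le_mul_of_nonneg_left hbd (by positivity : 0 ≤ 8 * b ^ 2 * t ^ 2)
  have h6 := Real.add_one_le_exp (t * ∫ ω, W ω ∂P + 16 * b ^ 2 * t ^ 2)
  linarith

/-- Bernstein's inequality for independent variables with a common mean and an exponential
moment, in the sub-Gaussian range `x ≤ 16 b` of deviations. -/
lemma measure_sum_ge_le_of_exp_moment {Ω : Type*} [MeasurableSpace Ω] {P : Measure Ω}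
    [IsProbabilityMeasure P] {n : ℕ} {W : Fin n → Ω → ℝ} {b m x : ℝ} (hb : 0 < b)
    (hW : ∀ i, Measurable (W i)) (hind : iIndepFun W P)
    (hint : ∀ i, Integrable (fun ω => Real.exp (|W i ω| / b)) P)
    (hbd : ∀ i, ∫ ω, Real.exp (|W i ω| / b) ∂P ≤ 2) (hm : ∀ i, ∫ ω, W i ω ∂P = m)
    (hx : 0 ≤ x) (hxb : x ≤ 16 * b) :
    P.real {ω | n * (m + x) ≤ ∑ i, W i ω} ≤ Real.exp (-(n * x ^ 2 / (64 * b ^ 2))) := by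
  -- the minimizer of `16 b² t² - t x`
  set t := x / (32 * b ^ 2) with ht
  have ht0 : 0 ≤ t := by positivity
  have htb : |t| * (2 * b) ≤ 1 := by
    rw [abs_of_nonneg ht0, ht]
    field_simp
    linarith
  have key := fun i => integral_exp_mul_le hb (hW i) (hint i) (hbd i) htb
  have hI : Integrable (fun ω => Real.exp (t * (∑ i, W i) ω)) P :=
    hind.integrable_exp_mul_sum hW fun i _ => (key i).1
  have h1 := measure_ge_le_exp_mul_mgf (n * (m + x)) ht0 hI
  rw [hind.mgf_sum hW] at h1
  have h2 : ∏ i, mgf (W i) P t ≤ ∏ _i : Fin n, Real.exp (t * m + 16 * b ^ 2 * t ^ 2) := by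
    refine Finset.prod_le_prod (fun i _ => mgf_nonneg) fun i _ => ?_
    have := (key i).2
    rwa [hm i] at this
  rw [Finset.prod_const, Finset.card_univ, Fintype.card_fin, ← Real.exp_nat_mul] at h2
  have h3 := mul_le_mul_of_nonneg_left h2 (Real.exp_pos (-t * (n * (m + x)))).le
  rw [← Real.exp_add] at h3
  have h4 : -t * (n * (m + x)) + n * (t * m + 16 * b ^ 2 * t ^ 2) =
      -(n * x ^ 2 / (64 * b ^ 2)) := by
    rw [ht]
    field_simp
    ring
  rw [h4] at h3
  simp only [Finset.sum_apply] at h1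
  exact h1.trans h3

/-- A two-sided deviation of a mean is an upper deviation of the sum or of its negative. -/
lemma measure_abs_mean_sub_ge_le {Ω : Type*} [MeasurableSpace Ω] {P : Measure Ω}
    [IsFiniteMeasure P] {n : ℕ} (hn : 0 < n) {W : Fin n → Ω → ℝ} {m x q : ℝ}
    (h1 : P.real {ω | n * (m + x) ≤ ∑ i, W i ω} ≤ q)
    (h2 : P.real {ω | n * (-m + x) ≤ ∑ i, -W i ω} ≤ q) :
    P.real {ω | x < |1 / (n : ℝ) * ∑ i, W i ω - m|} ≤ 2 * q := by
  have hn' : (0 : ℝ) < n := by exact_mod_cast hn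
  have hsub : {ω | x < |1 / (n : ℝ) * ∑ i, W i ω - m|} ⊆
      {ω | n * (m + x) ≤ ∑ i, W i ω} ∪ {ω | n * (-m + x) ≤ ∑ i, -W i ω} := by
    intro ω hω
    simp only [Set.mem_ofPred_eq, Set.mem_union, Finset.sum_neg_distrib] at hω ⊢
    have e : ∑ i, W i ω = n * (1 / (n : ℝ) * ∑ i, W i ω) := by field_simp
    rw [e]
    rcases lt_abs.1 hω with h | h
    · left
      gcongr
      linarith
    · right
      rw [← mul_neg]
      gcongr
      linarith
  linarith [(measureReal_mono (μ := P) hsub).trans (measureReal_union_le _ _)]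

lemma measure_mean_mul_sub_ge_le {Ω : Type*} [MeasurableSpace Ω] {P : Measure Ω}
    [IsProbabilityMeasure P] {n : ℕ} (hn : 0 < n) {Y Z : Fin n → Ω → ℝ} {v : ℝ≥0} {m x : ℝ}
    (hv : 0 < v) (hY : ∀ i, Measurable (Y i)) (hZ : ∀ i, Measurable (Z i))
    (hind : iIndepFun (fun i ω => Y i ω * Z i ω) P)
    (hsY : ∀ i, HasSubgaussianMGF (Y i) v P) (hsZ : ∀ i, HasSubgaussianMGF (Z i) v P)
    (hm : ∀ i, ∫ ω, Y i ω * Z i ω ∂P = m) (hx : 0 ≤ x) (hxv : x ≤ 64 * v) :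
    P.real {ω | x < |1 / (n : ℝ) * ∑ i, Y i ω * Z i ω - m|} ≤
      2 * Real.exp (-(n * x ^ 2 / (1024 * (v : ℝ) ^ 2))) := by
  have hv' : (0 : ℝ) < v := hv
  have e : 1024 * (v : ℝ) ^ 2 = 64 * (4 * v) ^ 2 := by ring
  rw [e]
  have hI := fun i => integrable_exp_abs_mul hv (hY i) (hZ i) (hsY i) (hsZ i)
  have hB := fun i => integral_exp_abs_mul_le hv (hY i) (hZ i) (hsY i) (hsZ i)
  refine measure_abs_mean_sub_ge_le hn ?_ ?_
  · exact measure_sum_ge_le_of_exp_moment (W := fun i ω => Y i ω * Z i ω) (by positivity)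
      (fun i => (hY i).mul (hZ i)) hind hI hB hm hx (by linarith)
  · refine measure_sum_ge_le_of_exp_moment (W := fun i ω => -(Y i ω * Z i ω)) (by positivity)
      (fun i => ((hY i).mul (hZ i)).neg) ?_ ?_ ?_ ?_ hx (by linarith)
    · exact hind.comp (fun _ x => -x) fun _ => measurable_neg
    · simpa only [abs_neg] using hI
    · simpa only [abs_neg] using hB
    · intro i
      rw [integral_neg, hm i]

lemma measure_mean_const_mul_ge_le {Ω : Type*} [MeasurableSpace Ω] {P : Measure Ω}
    [IsProbabilityMeasure P] {n : ℕ} (hn : 0 < n) {r : Fin n → ℝ} {Y : Fin n → Ω → ℝ} {v : ℝ≥0}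
    {x : ℝ} (hv : 0 < v) (hind : iIndepFun Y P) (hsY : ∀ i, HasSubgaussianMGF (Y i) v P)
    (hr : ∑ i, r i ^ 2 ≤ n) (hx : 0 ≤ x) :
    P.real {ω | x < |1 / (n : ℝ) * ∑ i, r i * Y i ω|} ≤
      2 * Real.exp (-(n * x ^ 2 / (2 * v))) := by
  have hn' : (0 : ℝ) < n := by exact_mod_cast hn
  have hv' : (0 : ℝ) < v := hv
  have hsum : HasSubgaussianMGF (fun ω => ∑ i, r i * Y i ω) (n * v) P := by
    have hterm : ∀ i, HasSubgaussianMGF (fun ω => r i * Y i ω) ((r i ^ 2).toNNReal * v) P :=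
      fun i => hasSubgaussianMGF_mono ((hsY i).const_mul (r i))
        (le_of_eq (by rw [Real.toNNReal_of_nonneg (sq_nonneg _)]; rfl))
    refine hasSubgaussianMGF_mono (HasSubgaussianMGF.sum_of_iIndepFun
      (hind.comp (fun i y => r i * y) fun i => by fun_prop) fun i _ => hterm i) ?_
    rw [← Finset.sum_mul, ← Real.toNNReal_sum_of_nonneg fun i _ => sq_nonneg (r i)]
    gcongr
    exact Real.toNNReal_le_iff_le_coe.2 (by exact_mod_cast hr)
  have h := measure_abs_mean_sub_ge_le (P := P) (m := 0) (x := x)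
    (q := Real.exp (-(n * x ^ 2 / (2 * v)))) hn (W := fun i ω => r i * Y i ω) ?_ ?_
  · simpa only [sub_zero] using h
  all_goals
    have e : Real.exp (-(n * x ^ 2 / (2 * v))) =
        Real.exp (-(n * x) ^ 2 / (2 * ((n * v : ℝ≥0) : ℝ))) := by
      congr 1
      push_cast
      field_simp
    rw [e]
  · simpa only [zero_add] using hsum.measure_ge_le (by positivity : 0 ≤ n * x)
  · have := hsum.neg.measure_ge_le (by positivity : 0 ≤ n * x)
    simpa only [neg_zero, zero_add, Finset.sum_neg_distrib, Pi.neg_apply] using this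

/-- Two independent families of independent variables form a family of independent pairs. -/
lemma iIndepFun_prodMk {Ω α β ι : Type*} [MeasurableSpace Ω] [MeasurableSpace α]
    [MeasurableSpace β] [Fintype ι] {P : Measure Ω} [IsProbabilityMeasure P] {X : ι → Ω → α}
    {Y : ι → Ω → β} (hX : ∀ i, Measurable (X i)) (hY : ∀ i, Measurable (Y i))
    (hindX : iIndepFun X P) (hindY : iIndepFun Y P)
    (hXY : IndepFun (fun ω i => X i ω) (fun ω i => Y i ω) P) :
    iIndepFun (fun i ω => (X i ω, Y i ω)) P := by
  have hpair : ∀ i, P.map (fun ω => (X i ω, Y i ω)) = (P.map (X i)).prod (P.map (Y i)) := fun i =>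
    (indepFun_iff_map_prod_eq_prod_map_map (hX i).aemeasurable (hY i).aemeasurable).1
      (hXY.comp (measurable_pi_apply i) (measurable_pi_apply i))
  have hX' : Measurable fun ω i => X i ω := measurable_pi_lambda _ hX
  have hY' : Measurable fun ω i => Y i ω := measurable_pi_lambda _ hY
  have : ∀ i, IsProbabilityMeasure (P.map (X i)) := fun i =>
    Measure.isProbabilityMeasure_map (hX i).aemeasurable
  have : ∀ i, IsProbabilityMeasure (P.map (Y i)) := fun i =>
    Measure.isProbabilityMeasure_map (hY i).aemeasurable
  rw [iIndepFun_iff_map_fun_eq_pi_map fun i => ((hX i).prodMk (hY i)).aemeasurable]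
  simp_rw [hpair]
  have hmp := measurePreserving_arrowProdEquivProdArrow α β ι (fun i => P.map (X i))
    (fun i => P.map (Y i))
  have h1 := (indepFun_iff_map_prod_eq_prod_map_map hX'.aemeasurable hY'.aemeasurable).1 hXY
  rw [hindX.map_fun_eq_pi_map fun i => (hX i).aemeasurable,
    hindY.map_fun_eq_pi_map fun i => (hY i).aemeasurable] at h1
  rw [← hmp.symm.map_eq, ← h1, Measure.map_map (MeasurableEquiv.measurable _)
    (hX'.prodMk hY')]
  rfl

/-! ### The averages of the measurement error model -/

/-- The event that the four empirical averages of error terms, the entries of `XᵀA/n`,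
`AᵀA/n - Σ_A`, `Xᵀε/n` and `Aᵀε/n`, are all within `x` of zero. -/
def smallErrorEvent {Ω : Type*} {n p : ℕ} (X : Matrix (Fin n) (Fin p) ℝ)
    (A : Ω → Matrix (Fin n) (Fin p) ℝ) (ε : Ω → Fin n → ℝ) (SigA : Matrix (Fin p) (Fin p) ℝ)
    (x : ℝ) : Set Ω :=
  {ω | ∀ j k, |1 / (n : ℝ) * ∑ i, X i j * A ω i k| ≤ x ∧
    |1 / (n : ℝ) * ∑ i, A ω i j * A ω i k - SigA j k| ≤ x ∧
    |1 / (n : ℝ) * ∑ i, X i j * ε ω i| ≤ x ∧ |1 / (n : ℝ) * ∑ i, A ω i j * ε ω i| ≤ x}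

section Model

variable {Ω : Type*} [MeasurableSpace Ω] {P : Measure Ω} {n p : ℕ}
  {A : Ω → Matrix (Fin n) (Fin p) ℝ} {ε : Ω → Fin n → ℝ}
  {SigA : Matrix (Fin p) (Fin p) ℝ} {τ σ : ℝ≥0}

lemma AdditiveErrorModel.entry_subGaussian (h : AdditiveErrorModel P A ε SigA τ σ)
    (i : Fin n) (j : Fin p) : HasSubgaussianMGF (fun ω => A ω i j) (τ ^ 2) P := by
  have h1 := h.rows_subGaussian i (Pi.single j 1) (by simp [l2norm])
  simpa [Pi.single_apply] using h1

lemma AdditiveErrorModel.isHermitian (h : AdditiveErrorModel P A ε SigA τ σ) (hn : 0 < n) :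
    SigA.IsHermitian := by
  ext j k
  simp only [Matrix.conjTranspose_apply, star_trivial]
  rw [← h.rows_cov ⟨0, hn⟩ k j, ← h.rows_cov ⟨0, hn⟩ j k, covariance_comm]

lemma AdditiveErrorModel.integral_mul (h : AdditiveErrorModel P A ε SigA τ σ)
    (i : Fin n) (j k : Fin p) : ∫ ω, A ω i j * A ω i k ∂P = SigA j k := by
  rw [← h.rows_cov i j k, covariance, h.rows_mean, h.rows_mean]
  simp

lemma AdditiveErrorModel.integral_mul_noise (h : AdditiveErrorModel P A ε SigA τ σ)
    (i : Fin n) (j : Fin p) : ∫ ω, A ω i j * ε ω i ∂P = 0 := by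
  have h1 : IndepFun (fun ω => A ω i j) (fun ω => ε ω i) P :=
    h.indep.comp (φ := fun a : Fin n → Fin p → ℝ => a i j) (ψ := fun a : Fin n → ℝ => a i)
      (by fun_prop) (by fun_prop)
  rw [h1.integral_fun_mul_eq_mul_integral (h.measurable_A i j).aestronglyMeasurable
    (h.measurable_ε i).aestronglyMeasurable, h.rows_mean, zero_mul]

lemma AdditiveErrorModel.iIndepFun_entry_mul_noise [IsProbabilityMeasure P]
    (h : AdditiveErrorModel P A ε SigA τ σ) (j : Fin p) :
    iIndepFun (fun i ω => A ω i j * ε ω i) P := by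
  have h1 := iIndepFun_prodMk (fun i => measurable_pi_lambda _ (h.measurable_A i))
    h.measurable_ε h.rows_indep h.noise_indep h.indep
  exact h1.comp (fun _ q => q.1 j * q.2) fun _ => by fun_prop

lemma AdditiveErrorModel.measurableSet_smallErrorEvent (h : AdditiveErrorModel P A ε SigA τ σ)
    (X : Matrix (Fin n) (Fin p) ℝ) (x : ℝ) : MeasurableSet (smallErrorEvent X A ε SigA x) := by
  have hA := h.measurable_A
  have hε := h.measurable_ε
  simp only [smallErrorEvent, measurableSet_setOfPred]
  fun_prop

/-- Union bound over the entries. The number `v` is a common sub-Gaussian parameter of all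
variables; `v ≥ 1 / 4` lets the Bernstein rate `x² / v²` serve for the linear averages too, whose
own rate is `x² / v`. -/
lemma AdditiveErrorModel.one_sub_le_smallErrorEvent [IsProbabilityMeasure P]
    (h : AdditiveErrorModel P A ε SigA τ σ) (hn : 0 < n) {X : Matrix (Fin n) (Fin p) ℝ}
    (hX : ∀ j, ∑ i, X i j ^ 2 ≤ (n : ℝ)) {v : ℝ≥0} {x : ℝ} (hτ : τ ^ 2 ≤ v) (hσ : σ ^ 2 ≤ v)
    (hv : 1 / 4 ≤ (v : ℝ)) (hx : 0 ≤ x) (hxv : x ≤ 64 * v) :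
    1 - 8 * (p : ℝ) ^ 2 * Real.exp (-(n * x ^ 2 / (1024 * (v : ℝ) ^ 2))) ≤
      P.real (smallErrorEvent X A ε SigA x) := by
  have hv' : (0 : ℝ) < v := by linarith
  have hv0 : 0 < v := hv'
  set q := Real.exp (-(n * x ^ 2 / (1024 * (v : ℝ) ^ 2))) with hq
  have hAs := fun i j => hasSubgaussianMGF_mono (h.entry_subGaussian i j) hτ
  have hεs := fun i => hasSubgaussianMGF_mono (h.noise_subGaussian i) hσ
  have hlin : 2 * Real.exp (-(n * x ^ 2 / (2 * v))) ≤ 2 * q := by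
    have hvv : 2 * (v : ℝ) ≤ 1024 * (v : ℝ) ^ 2 := by nlinarith
    rw [hq]
    gcongr 2 * Real.exp (-(_ / ?_))
  have b1 : ∀ j k, P.real {ω | x < |1 / (n : ℝ) * ∑ i, X i j * A ω i k|} ≤ 2 * q := fun j k =>
    (measure_mean_const_mul_ge_le hn hv0
      (h.rows_indep.comp (fun _ a => a k) fun _ => measurable_pi_apply k)
      (fun i => hAs i k) (hX j) hx).trans hlin
  have b2 : ∀ j k, P.real {ω | x < |1 / (n : ℝ) * ∑ i, A ω i j * A ω i k - SigA j k|} ≤ 2 * q :=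
    fun j k => measure_mean_mul_sub_ge_le hn hv0 (fun i => h.measurable_A i j)
      (fun i => h.measurable_A i k)
      (h.rows_indep.comp (fun _ a => a j * a k) fun _ => by fun_prop)
      (fun i => hAs i j) (fun i => hAs i k) (fun i => h.integral_mul i j k) hx hxv
  have b3 : ∀ j, P.real {ω | x < |1 / (n : ℝ) * ∑ i, X i j * ε ω i|} ≤ 2 * q := fun j =>
    (measure_mean_const_mul_ge_le hn hv0 h.noise_indep hεs (hX j) hx).trans hlin
  have b4 : ∀ j, P.real {ω | x < |1 / (n : ℝ) * ∑ i, A ω i j * ε ω i|} ≤ 2 * q :=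
    fun j => by
      simpa only [sub_zero] using
        measure_mean_mul_sub_ge_le hn hv0 (fun i => h.measurable_A i j) h.measurable_ε
          (h.iIndepFun_entry_mul_noise j) (fun i => hAs i j) hεs
          (fun i => h.integral_mul_noise i j) hx hxv
  set B : Fin p × Fin p → Set Ω := fun jk =>
    ({ω | x < |1 / (n : ℝ) * ∑ i, X i jk.1 * A ω i jk.2|} ∪
      {ω | x < |1 / (n : ℝ) * ∑ i, A ω i jk.1 * A ω i jk.2 - SigA jk.1 jk.2|}) ∪
    ({ω | x < |1 / (n : ℝ) * ∑ i, X i jk.1 * ε ω i|} ∪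
      {ω | x < |1 / (n : ℝ) * ∑ i, A ω i jk.1 * ε ω i|}) with hB
  have hBle : ∀ jk, P.real (B jk) ≤ 8 * q := fun jk => by
    have h1 := b1 jk.1 jk.2
    have h2 := b2 jk.1 jk.2
    have h3 := b3 jk.1
    have h4 := b4 jk.1
    refine (measureReal_union_le _ _).trans ?_
    refine (add_le_add (measureReal_union_le _ _) (measureReal_union_le _ _)).trans ?_
    linarith
  have hsub : (smallErrorEvent X A ε SigA x)ᶜ ⊆ ⋃ jk, B jk := by
    intro ω hω
    by_contra hcon
    refine hω fun j k => ?_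
    simp only [hB, Set.mem_iUnion, Set.mem_union, Set.mem_ofPred_eq, not_exists, not_or,
      not_lt] at hcon
    have := hcon (j, k)
    exact ⟨this.1.1, this.1.2, this.2.1, this.2.2⟩
  have hcompl : P.real (smallErrorEvent X A ε SigA x)ᶜ ≤ 8 * (p : ℝ) ^ 2 * q := by
    calc P.real (smallErrorEvent X A ε SigA x)ᶜ ≤ P.real (⋃ jk, B jk) := measureReal_mono hsub
      _ ≤ ∑ jk, P.real (B jk) := measureReal_iUnion_fintype_le _
      _ ≤ ∑ _jk : Fin p × Fin p, 8 * q := Finset.sum_le_sum fun jk _ => hBle jk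
      _ = 8 * (p : ℝ) ^ 2 * q := by
          simp only [Finset.sum_const, Finset.card_univ, Fintype.card_prod, Fintype.card_fin,
            nsmul_eq_mul]
          push_cast
          ring
  rw [probReal_compl_eq_one_sub (h.measurableSet_smallErrorEvent X x)] at hcompl
  linarith

end Model

/-! ### The surrogates on the event of small averages -/

lemma gram_posSemidef {n p : ℕ} (Z : Matrix (Fin n) (Fin p) ℝ) : (gram Z).PosSemidef := by
  have h := Matrix.posSemidef_conjTranspose_mul_self Z
  rw [Matrix.conjTranspose_eq_transpose_of_trivial] at h
  exact h.smul (by positivity)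

open scoped MatrixOrder in
lemma surrogateSigma_add_posSemidef {n p : ℕ} (Z : Matrix (Fin n) (Fin p) ℝ)
    {SigA : Matrix (Fin p) (Fin p) ℝ} (h : SigA.IsHermitian) :
    (surrogateSigma Z SigA + lamMax SigA • (1 : Matrix (Fin p) (Fin p) ℝ)).PosSemidef := by
  have h1 := Matrix.le_iff.1 (le_lamMax h)
  rw [Algebra.algebraMap_eq_smul_one] at h1
  have h2 := (gram_posSemidef Z).add h1
  have e : surrogateSigma Z SigA + lamMax SigA • (1 : Matrix (Fin p) (Fin p) ℝ) =
      gram Z + (lamMax SigA • (1 : Matrix (Fin p) (Fin p) ℝ) - SigA) := by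
    rw [surrogateSigma]
    abel
  rwa [e]

open scoped MatrixOrder in
lemma clippedMatrix_posSemidef {p : ℕ} {e : ℝ} (he : 0 < e) (M : Matrix (Fin p) (Fin p) ℝ) :
    (clippedMatrix e M).PosSemidef :=
  Matrix.nonneg_iff_posSemidef.1 (cfc_nonneg fun _ _ => he.le.trans (le_max_right _ _))

lemma RestrictedEigenvalue.mono {p : ℕ} {M M' : Matrix (Fin p) (Fin p) ℝ} {T : Finset (Fin p)}
    {κ : ℝ} (h : RestrictedEigenvalue M T κ) (hM : (M' - M).PosSemidef) :
    RestrictedEigenvalue M' T κ := by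
  refine ⟨h.1, fun b hb => ?_⟩
  have h1 := h.2 b hb
  have h2 := hM.dotProduct_mulVec_nonneg b
  rw [star_trivial, Matrix.sub_mulVec, dotProduct_sub] at h2
  linarith

/-- Entrywise, `Σ̂ - Σ = (XᵀA + AᵀX)/n + (AᵀA/n - Σ_A)`. -/
lemma abs_surrogateSigma_sub_gram_le {n p : ℕ} {X A : Matrix (Fin n) (Fin p) ℝ}
    {SigA : Matrix (Fin p) (Fin p) ℝ} {x : ℝ}
    (h1 : ∀ j k, |1 / (n : ℝ) * ∑ i, X i j * A i k| ≤ x)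
    (h2 : ∀ j k, |1 / (n : ℝ) * ∑ i, A i j * A i k - SigA j k| ≤ x) (j k : Fin p) :
    |(surrogateSigma (X + A) SigA - gram X) j k| ≤ 3 * x := by
  have e : (surrogateSigma (X + A) SigA - gram X) j k =
      1 / (n : ℝ) * ∑ i, X i j * A i k + 1 / (n : ℝ) * ∑ i, X i k * A i j +
        (1 / (n : ℝ) * ∑ i, A i j * A i k - SigA j k) := by
    simp only [surrogateSigma, gram, Matrix.sub_apply, Matrix.smul_apply, Matrix.mul_apply,
      Matrix.transpose_apply, Matrix.add_apply, smul_eq_mul, add_mul, mul_add,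
      Finset.sum_add_distrib]
    have : ∑ i, A i j * X i k = ∑ i, X i k * A i j :=
      Finset.sum_congr rfl fun i _ => mul_comm _ _
    rw [this]
    ring
  rw [e]
  have := abs_add_three (1 / (n : ℝ) * ∑ i, X i j * A i k) (1 / (n : ℝ) * ∑ i, X i k * A i j)
    (1 / (n : ℝ) * ∑ i, A i j * A i k - SigA j k)
  linarith [h1 j k, h1 k j, h2 j k]

/-- `ξ̂ - Σ̂ β* = Xᵀε/n + Aᵀε/n - (XᵀA/n + AᵀA/n - Σ_A) β*`: correcting the Gram matrix by `Σ_A`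
removes the bias of the corrupted design, and only centred averages remain. -/
lemma abs_surrogateXi_sub_le {n p : ℕ} {X A : Matrix (Fin n) (Fin p) ℝ}
    {SigA : Matrix (Fin p) (Fin p) ℝ} {ε : Fin n → ℝ} {x : ℝ}
    (h1 : ∀ j k, |1 / (n : ℝ) * ∑ i, X i j * A i k| ≤ x)
    (h2 : ∀ j k, |1 / (n : ℝ) * ∑ i, A i j * A i k - SigA j k| ≤ x)
    (h3 : ∀ j, |1 / (n : ℝ) * ∑ i, X i j * ε i| ≤ x)
    (h4 : ∀ j, |1 / (n : ℝ) * ∑ i, A i j * ε i| ≤ x) (βs : Fin p → ℝ) (j : Fin p) :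
    |(surrogateXi (X + A) (X *ᵥ βs + ε) - surrogateSigma (X + A) SigA *ᵥ βs) j| ≤
      2 * x * l1norm βs + 2 * x := by
  set N : Matrix (Fin p) (Fin p) ℝ := (1 / (n : ℝ)) • (Xᵀ * A) +
    ((1 / (n : ℝ)) • (Aᵀ * A) - SigA) with hN
  have hNle : ∀ j k, |N j k| ≤ 2 * x := fun j k => by
    have e : N j k = 1 / (n : ℝ) * ∑ i, X i j * A i k +
        (1 / (n : ℝ) * ∑ i, A i j * A i k - SigA j k) := by
      simp [hN, Matrix.mul_apply]
    rw [e]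
    refine (abs_add_le _ _).trans ?_
    linarith [h1 j k, h2 j k]
  have hvec : surrogateXi (X + A) (X *ᵥ βs + ε) - surrogateSigma (X + A) SigA *ᵥ βs =
      (1 / (n : ℝ)) • (Xᵀ *ᵥ ε) + (1 / (n : ℝ)) • (Aᵀ *ᵥ ε) - N *ᵥ βs := by
    simp only [surrogateXi, surrogateSigma, gram, hN, Matrix.transpose_add, Matrix.add_mulVec,
      Matrix.mulVec_add, Matrix.sub_mulVec, Matrix.smul_mulVec, Matrix.mulVec_mulVec,
      Matrix.add_mul, Matrix.mul_add, smul_add]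
    abel
  have e3 : ((1 / (n : ℝ)) • (Xᵀ *ᵥ ε)) j = 1 / (n : ℝ) * ∑ i, X i j * ε i := by
    simp [Matrix.mulVec, dotProduct]
  have e4 : ((1 / (n : ℝ)) • (Aᵀ *ᵥ ε)) j = 1 / (n : ℝ) * ∑ i, A i j * ε i := by
    simp [Matrix.mulVec, dotProduct]
  rw [hvec, Pi.sub_apply, Pi.add_apply, e3, e4]
  refine (abs_sub _ _).trans ?_
  have h5 := abs_mulVec_le hNle βs j
  have h6 := abs_add_le (1 / (n : ℝ) * ∑ i, X i j * ε i) (1 / (n : ℝ) * ∑ i, A i j * ε i)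
  linarith [h3 j, h4 j]

theorem corollary1 :
    ∃ C c : ℝ, 0 < C ∧ 0 < c ∧
    ∃ ζ : ℝ → ℝ → ℝ → ℝ → ℝ → ℝ, (∀ b t v k l : ℝ, 0 < ζ b t v k l) ∧
    ∀ (n p : ℕ) (_hn : 0 < n) (X : Matrix (Fin n) (Fin p) ℝ) (βs : Fin p → ℝ)
      (Ω : Type*) [MeasurableSpace Ω] (P : Measure Ω) [IsProbabilityMeasure P]
      (A : Ω → Matrix (Fin n) (Fin p) ℝ) (ε : Ω → Fin n → ℝ)
      (SigA : Matrix (Fin p) (Fin p) ℝ) (τ σ : ℝ≥0) (κ e : ℝ)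
      (_hX : ∀ j, ∑ i, X i j ^ 2 ≤ (n : ℝ))
      (_hβ : βs ≠ 0)
      (_hτ : 0 < τ) (_hσ : 0 < σ) (_he : 0 < e)
      (_hmodel : AdditiveErrorModel P A ε SigA τ σ)
      (_hSigA : 0 < lamMax SigA)
      (_hREC : RestrictedEigenvalue (gram X) (suppSet βs) κ),
      ∃ E : Set Ω, MeasurableSet E ∧
        1 - C * (p : ℝ) ^ 2 * Real.exp (-(c * (n : ℝ) * (((suppSet βs).card : ℝ) ^ 2)⁻¹ *
            (ζ (l1norm βs) ((τ : ℝ) ^ 2) ((σ : ℝ) ^ 2) κ (lamMax SigA))⁻¹)) ≤ P.real E ∧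
        ∀ ω ∈ E, ∀ (a lam : ℝ) (ρ : ℕ → ℝ) (w β : ℕ → Fin p → ℝ), 1 < a →
          IsAlgorithmRun n
            (calibratedDesign n e (surrogateSigma (X + A ω) SigA))
            (calibratedResponse n e (surrogateSigma (X + A ω) SigA)
              (surrogateXi (X + A ω) (X *ᵥ βs + ε ω)))
            a lam ρ w β →
          8 * (2 * (lamMax SigA + e) * l1norm βs) ≤ lam →
          ρ 3 ≤ κ / (4 * √2 * lam) →
          ∀ k : ℕ, 1 ≤ k →
            l2norm (β k - βs) ≤ 4 * √((suppSet βs).card : ℝ) * lam / κ := by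
  -- `ζ = (v * m)²`, where `v` bounds the sub-Gaussian parameters and `x = 1 / (s * m)` is a
  -- deviation small enough for the restricted eigenvalues and for the noise level at once
  refine ⟨8, 1 / 1024, by norm_num, by norm_num, fun b t v k l =>
    ((1 / 4 + |t| + |v|) * (1 + 200 / |k| + 4 / |l| + 4 / |l * b|)) ^ 2,
    fun b t v k l => by positivity, ?_⟩
  intro n p hn X βs Ω _ P _ A ε SigA τ σ κ e hX hβ _ _ he hmodel hSigA hREC
  have hκ : 0 < κ := hREC.1
  set l := lamMax SigA with hl
  set b := l1norm βs with hb
  obtain ⟨j₀, hj₀⟩ : ∃ j, βs j ≠ 0 := Function.ne_iff.1 hβ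
  have hb0 : 0 < b := by
    refine (abs_pos.2 hj₀).trans_le ?_
    exact Finset.single_le_sum (f := fun j => |βs j|) (fun j _ => abs_nonneg _)
      (Finset.mem_univ j₀)
  set s : ℝ := ((suppSet βs).card : ℝ) with hs
  have hs1 : 1 ≤ s := by
    have : 0 < (suppSet βs).card := Finset.card_pos.2 ⟨j₀, by simpa [suppSet] using hj₀⟩
    rw [hs]
    exact_mod_cast this
  set m : ℝ := 1 + 200 / |κ| + 4 / |l| + 4 / |l * b| with hm
  rw [abs_of_pos hκ, abs_of_pos hSigA, abs_of_pos (mul_pos hSigA hb0)] at hm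
  have hm1 : 0 < 200 / κ := by positivity
  have hm2 : 0 < 4 / l := by positivity
  have hm3 : 0 < 4 / (l * b) := by positivity
  have hm0 : 0 < m := by linarith
  set v : ℝ≥0 := 1 / 4 + τ ^ 2 + σ ^ 2 with hv
  have hvR : (v : ℝ) = 1 / 4 + |(τ : ℝ) ^ 2| + |(σ : ℝ) ^ 2| := by
    rw [abs_of_nonneg (by positivity), abs_of_nonneg (by positivity), hv]
    push_cast
    rfl
  have hv4 : 1 / 4 ≤ (v : ℝ) := by
    rw [hvR]
    linarith [abs_nonneg ((τ : ℝ) ^ 2), abs_nonneg ((σ : ℝ) ^ 2)]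
  set x : ℝ := 1 / (s * m) with hx
  have hx0 : 0 < x := by positivity
  have hxm : x * m ≤ 1 := by
    have : x * m = 1 / s := by rw [hx]; field_simp
    rw [this]
    exact (div_le_one (by linarith)).2 hs1
  have hx1 : x ≤ 1 := by nlinarith
  have hxl : 4 * x ≤ l := by
    have : x * (4 / l) ≤ 1 := by nlinarith
    rwa [mul_div_assoc', div_le_one hSigA, mul_comm] at this
  have hxlb : 4 * x ≤ l * b := by
    have : x * (4 / (l * b)) ≤ 1 := by nlinarith
    rwa [mul_div_assoc', div_le_one (by positivity), mul_comm] at this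
  have hxκ : 48 * s * (3 * x) ≤ κ := by
    have h1 : s * x * m = 1 := by rw [hx]; field_simp
    have h2 : s * x * (200 / κ) ≤ 1 := by
      rw [← h1]
      gcongr
      linarith
    rw [mul_div_assoc', div_le_one hκ] at h2
    nlinarith
  refine ⟨smallErrorEvent X A ε SigA x, hmodel.measurableSet_smallErrorEvent X x, ?_, ?_⟩
  · refine le_of_eq_of_le ?_ (hmodel.one_sub_le_smallErrorEvent hn hX (v := v) (x := x)
      (by rw [hv]; exact le_add_right (le_add_left le_rfl)) (by rw [hv]; exact le_add_left le_rfl)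
      hv4 hx0.le (by linarith))
    congr 4
    beta_reduce
    rw [abs_of_pos hκ, abs_of_pos hSigA, abs_of_pos (mul_pos hSigA hb0), ← hm, ← hvR, hx]
    field_simp
  · intro ω hω a lam ρ w β ha hrun hlam hρ k hk
    have h1 := fun j k => (hω j k).1
    have h2 := fun j k => (hω j k).2.1
    have h3 := fun j => (hω j j).2.2.1
    have h4 := fun j => (hω j j).2.2.2
    set M := surrogateSigma (X + A ω) SigA with hM
    set ξ := surrogateXi (X + A ω) (X *ᵥ βs + ε ω) with hξ
    have hSym := hmodel.isHermitian hn
    have hMH : M.IsHermitian := (gram_posSemidef (X + A ω)).1.sub hSym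
    have hRE : RestrictedEigenvalue M (suppSet βs) (κ / 2) := by
      have := hREC.half_of_perturbation (abs_surrogateSigma_sub_gram_le h1 h2) (by positivity) hxκ
      rwa [add_sub_cancel] at this
    have hclip : (clippedMatrix e M - M).PosSemidef := clippedMatrix_sub_posSemidef e hMH
    refine hrun.l2norm_sub_le hn he hMH ha (clippedMatrix_posSemidef he M) (hRE.mono hclip)
      (fun j => ?_) hρ k hk
    -- the noise takes at most half of `2 (l + e) b ≤ lam / 8`, and the clipping the other half
    have hsplit : ξ - clippedMatrix e M *ᵥ βs =
        (ξ - M *ᵥ βs) - (clippedMatrix e M - M) *ᵥ βs := by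
      rw [Matrix.sub_mulVec]
      abel
    have h5 := abs_surrogateXi_sub_le h1 h2 h3 h4 βs j
    have h6 := abs_mulVec_le (abs_apply_le_of_posSemidef hclip
      (smul_one_sub_clippedMatrix_posSemidef hMH (by linarith)
        (surrogateSigma_add_posSemidef (X + A ω) hSym))) βs j
    rw [hsplit, Pi.sub_apply]
    refine (abs_sub _ _).trans ?_
    nlinarith
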